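/- Let $s\ge 1$, let $p_2=2s+1$, $r_2=s$, $s+1\le p_1\le 2s+1$, $r_1=p_1-1$, and let $h=\frac1{k+1}$ with an integer $k\ge\max\{2(s+1)-p_1,\,2\}$. For $i=1,2$ let $\mathcal S_h^{p_i,r_i}([0,1])$ be the spline space spanned by the B-splines $N_j^{p_i,r_i}$, $j=0,\dots,n_i-1$, $n_i=p_i+1+k(p_i-r_i)$, of degree $p_i$ on the knot vector in which $0$ and $1$ occur $p_i+1$ times and each of $\frac1{k+1},\dots,\frac k{k+1}$ occurs $p_i-r_i$ times. Let $\mathcal S_h^{\mathbf p_i,\mathbf r_i}([0,1]^2)=\mathcal S_h^{p_i,r_i}([0,1])\otimes\mathcal S_h^{p_i,r_i}([0,1])$ and write $N^{\mathbf p_i,\mathbf r_i}_{j_1,j_2}(x,y)=N^{p_i,r_i}_{j_1}(x)N^{p_i,r_i}_{j_2}(y)$. With $N_i^{p_1,r_1}=\sum_{j=0}^{n_2-1}\mu_j^{(i)}N_j^{p_2,r_2}$ put $\overline N_i=\sum_{j=s+1}^{n_2-s-2}\mu_j^{(i)}N_j^{p_2,r_2}$ and $\overline N_{j_1,j_2}(x,y)=\overline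 N_{j_1}(x)\overline N_{j_2}(y)$. For $n\in\{n_1,n_2\}$ let $I_n=\{s+1,\dots,n-s-2\}$ and $O_n=\{0,\dots,s\}\cup\{n-s-1,\dots,n-1\}$, and let $T=\{1,\dots,s\}\cup\{n_1-s-1,\dots,n_1-2\}$. The mixed degree and regularity spline space $\mathcal S_h^{(\mathbf p_1,\mathbf p_2),(\mathbf r_1,\mathbf r_2)}([0,1]^2)$ is the sum of the three spaces $$\mathcal S_1=\operatorname{span}\{N^{\mathbf p_1,\mathbf r_1}_{j_1,j_2}: j_1,j_2\in I_{n_1}\},$$ $$\overline{\mathcal S}_1=\operatorname{span}\{\overline N_{j_1,j_2}: j_1\in T,\ 1\le j_2\le n_1-2\}+\operatorname{span}\{\overline N_{j_1,j_2}: j_1\in I_{n_1},\ j_2\in T\},$$ $$\mathcal S_2=\operatorname{span}\{N^{\mathbf p_2,\mathbf r_2}_{j_1,j_2}: j_1\in O_{n_2},\ 0\le j_2\le n_2-1\}+\operatorname{span}\{N^{\mathbf p_2,\mathbf r_2}_{j_1,j_2}: j_1\in I_{n_2},\ j_2\in O_{n_2}\}.$$ Then $$\mathcal S_h^{\mathbf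 p_1,\mathbf r_1}([0,1]^2)\subseteq\mathcal S_h^{(\mathbf p_1,\mathbf p_2),(\mathbf r_1,\mathbf r_2)}([0,1]^2)\subseteq\mathcal S_h^{\mathbf p_2,\mathbf r_2}([0,1]^2).$$ Moreover, the mixed space locally reproduces the polynomials of bidegree at most $(p_1,p_1)$: every such polynomial $q$, restricted to $[0,1]^2$, lies in the mixed space, and for each mesh cell $Q=[ah,(a+1)h]\times[bh,(b+1)h]$, $0\le a,b\le k$, there is a function $f$ in the mixed space with $f=q$ on $Q$ that vanishes on $[0,1]^2$ outside $[(a-p_1)h,(a+1+p_1)h]\times[(b-p_1)h,(b+1+p_1)h]$. -/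

import Mathlib

noncomputable section

namespace MixedSpline

/-- The `i`-th knot (counted from `0`) of the open knot vector on `[0,1]` of degree `p` and
regularity `r` with the `k` interior knots `1/(k+1), …, k/(k+1)`: the knots `0` and `1` are
repeated `p + 1` times, each interior knot is repeated `p - r` times. -/
def knot (k p r i : ℕ) : ℝ :=
  if i ≤ p then 0
  else if i < p + 1 + k * (p - r) then (((i - (p + 1)) / (p - r) + 1 : ℕ) : ℝ) / ((k : ℝ) + 1)
  else 1

/-- The B-splines of degree `q` on a nondecreasing knot sequence `t` in `[0,1]`, through the
Cox–de Boor recursion (with `0/0 = 0`). The knot spans are half open, except that the last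
nonempty one, which ends at `1`, contains `1`. -/
def coxDeBoor (t : ℕ → ℝ) : ℕ → ℕ → ℝ → ℝ
  | 0, i, x =>
    open Classical in
    if (t i ≤ x ∧ x < t (i + 1)) ∨ (t i < t (i + 1) ∧ t (i + 1) = 1 ∧ x = 1) then 1 else 0
  | q + 1, i, x =>
    (x - t i) / (t (i + q + 1) - t i) * coxDeBoor t q i x +
      (t (i + q + 2) - x) / (t (i + q + 2) - t (i + 1)) * coxDeBoor t q (i + 1) x

/-- The number `n_{p,r} = p + 1 + k (p - r)` of B-splines. -/
def numBSplines (k p r : ℕ) : ℕ := p + 1 + k * (p - r)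

/-- The B-spline `N_i^{p,r}` on `[0,1]`, for `i = 0, …, n_{p,r} - 1`. -/
def bspline (k p r i : ℕ) : unitInterval → ℝ :=
  fun x => coxDeBoor (knot k p r) p i (x : ℝ)

/-- The spline space `S_h^{p,r}([0,1])`, `h = 1/(k+1)`: the span of its B-splines. -/
def splineSpace (k p r : ℕ) : Submodule ℝ (unitInterval → ℝ) :=
  Submodule.span ℝ (bspline k p r '' Set.Iio (numBSplines k p r))

/-- The function `(x, y) ↦ f x * g y` on the unit square. -/
def tensorFun (f g : unitInterval → ℝ) : unitInterval × unitInterval → ℝ :=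
  fun z => f z.1 * g z.2

/-- The tensor-product spline space `S_h^{p,r}([0,1]) ⊗ S_h^{p,r}([0,1])` on `[0,1]^2`. -/
def tensorSplineSpace (k p r : ℕ) : Submodule ℝ (unitInterval × unitInterval → ℝ) :=
  Submodule.span ℝ (Set.image2 tensorFun (splineSpace k p r) (splineSpace k p r))

/-- The coefficients `μ_j^{(i)}`, `j = 0, …, n_{p₂,r₂} - 1`, of `N_i^{p₁,r₁}` with respect to the
B-splines `N_j^{p₂,r₂}`. -/
def coeff (k p₁ r₁ p₂ r₂ i : ℕ) : Fin (numBSplines k p₂ r₂) → ℝ :=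
  Classical.epsilon fun μ : Fin (numBSplines k p₂ r₂) → ℝ =>
    bspline k p₁ r₁ i = ∑ j, μ j • bspline k p₂ r₂ j

/-- The truncation of `N_i^{p₁,r₁}`: in its expansion in the B-splines `N_j^{p₂,r₂}` only the terms
with `s + 1 ≤ j ≤ n_{p₂,r₂} - s - 2` are kept. -/
def truncBSpline (s k p₁ r₁ p₂ r₂ i : ℕ) : unitInterval → ℝ :=
  ∑ j ∈ Finset.univ.filter fun j : Fin (numBSplines k p₂ r₂) =>
      s + 1 ≤ (j : ℕ) ∧ (j : ℕ) ≤ numBSplines k p₂ r₂ - s - 2,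
    coeff k p₁ r₁ p₂ r₂ i j • bspline k p₂ r₂ j

/-- The indices `s + 1, …, n - s - 2`. -/
def innerIdx (s n : ℕ) : Set ℕ := Set.Icc (s + 1) (n - s - 2)

/-- The indices `1, …, s` and `n - s - 1, …, n - 2`. -/
def truncIdx (s n : ℕ) : Set ℕ := Set.Icc 1 s ∪ Set.Icc (n - s - 1) (n - 2)

/-- The indices `0, …, s` and `n - s - 1, …, n - 1`. -/
def outerIdx (s n : ℕ) : Set ℕ := Set.Icc 0 s ∪ Set.Icc (n - s - 1) (n - 1)

/-- The span of the products `N_{j₁} N_{j₂}` of members of a univariate family, `j₁ ∈ A`,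
`j₂ ∈ B`. -/
def prodSpan (N : ℕ → unitInterval → ℝ) (A B : Set ℕ) :
    Submodule ℝ (unitInterval × unitInterval → ℝ) :=
  Submodule.span ℝ (Set.image2 (fun j₁ j₂ => tensorFun (N j₁) (N j₂)) A B)

/-- `S_1([0,1]^2)`: the low degree part in the interior. -/
def lowSpace (s k p₁ r₁ : ℕ) : Submodule ℝ (unitInterval × unitInterval → ℝ) :=
  prodSpan (bspline k p₁ r₁) (innerIdx s (numBSplines k p₁ r₁))
    (innerIdx s (numBSplines k p₁ r₁))

/-- The space spanned by the truncated low degree B-splines. -/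
def truncSpace (s k p₁ r₁ p₂ r₂ : ℕ) : Submodule ℝ (unitInterval × unitInterval → ℝ) :=
  prodSpan (truncBSpline s k p₁ r₁ p₂ r₂) (truncIdx s (numBSplines k p₁ r₁))
      (Set.Icc 1 (numBSplines k p₁ r₁ - 2)) ⊔
    prodSpan (truncBSpline s k p₁ r₁ p₂ r₂) (innerIdx s (numBSplines k p₁ r₁))
      (truncIdx s (numBSplines k p₁ r₁))

/-- `S_2([0,1]^2)`: the high degree part near the boundary. -/
def highSpace (s k p₂ r₂ : ℕ) : Submodule ℝ (unitInterval × unitInterval → ℝ) :=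
  prodSpan (bspline k p₂ r₂) (outerIdx s (numBSplines k p₂ r₂))
      (Set.Icc 0 (numBSplines k p₂ r₂ - 1)) ⊔
    prodSpan (bspline k p₂ r₂) (innerIdx s (numBSplines k p₂ r₂))
      (outerIdx s (numBSplines k p₂ r₂))

/-- The mixed degree and regularity spline space `S_h^{(p₁,p₂),(r₁,r₂)}([0,1]^2)`. -/
def mixedSpace (s k p₁ r₁ p₂ r₂ : ℕ) : Submodule ℝ (unitInterval × unitInterval → ℝ) :=
  lowSpace s k p₁ r₁ ⊔ truncSpace s k p₁ r₁ p₂ r₂ ⊔ highSpace s k p₂ r₂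

/-- The restriction of a bivariate polynomial to the unit square. -/
def polyFun (q : MvPolynomial (Fin 2) ℝ) : unitInterval × unitInterval → ℝ :=
  fun z => MvPolynomial.eval ![(z.1 : ℝ), (z.2 : ℝ)] q

/-- The interval from `a h` to `b h`, `h = 1/(k+1)`. -/
def meshInterval (k : ℕ) (a b : ℤ) : Set ℝ :=
  Set.Icc ((a : ℝ) / ((k : ℝ) + 1)) ((b : ℝ) / ((k : ℝ) + 1))

/-- The spline space `V` with mesh size `1/(k+1)` locally reproduces the polynomials of bidegree at
most `(p, p)`: it contains them, and on every mesh cell each of them agrees with some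
function of `V` that vanishes more than `p` cells away from that cell. -/
def LocallyReproduces (k p : ℕ) (V : Submodule ℝ (unitInterval × unitInterval → ℝ)) : Prop :=
  ∀ q : MvPolynomial (Fin 2) ℝ, (∀ i, q.degreeOf i ≤ p) →
    polyFun q ∈ V ∧
    ∀ a b : ℕ, a ≤ k → b ≤ k → ∃ f ∈ V,
      (∀ z : unitInterval × unitInterval, (z.1 : ℝ) ∈ meshInterval k a (a + 1) →
        (z.2 : ℝ) ∈ meshInterval k b (b + 1) → f z = polyFun q z) ∧
      (∀ z : unitInterval × unitInterval, f z ≠ 0 →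
        (z.1 : ℝ) ∈ meshInterval k (a - p) (a + 1 + p) ∧
        (z.2 : ℝ) ∈ meshInterval k (b - p) (b + 1 + p))

end MixedSpline

end

/-! Marsden's identity expands `(x - ξ) ^ e` in the B-splines of degree `p`, with the blossom of
this power at `p` consecutive knots as coefficients. At a breakpoint `ξ` and for `e > r` these
coefficients vanish for all B-splines that straddle `ξ`, so that keeping the B-splines on one side
of `ξ` expands a truncated power. The truncated powers are independent and as many as the
B-splines; hence both are bases of the spline space, and the spaces are nested because the sets of
truncated powers are.

The first and the last B-spline of the low degree space are multiples of truncated powers, whose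
expansions in the high degree space involve at most `s + 1` B-splines, all outer; by independence
their truncations vanish. A product of two low degree B-splines is either a generator of the mixed
space or differs from the product of the truncations, which is a generator or zero, by products of
high degree splines with an outer factor. Since B-splines have local support, a polynomial is
reproduced on a cell by those terms of its expansion that are active there.
-/

namespace MixedSpline

open Polynomial

/-! ### Marsden's identity -/

/-- A knot sequence for `coxDeBoor`: nondecreasing and bounded by `1`, the point at which
`coxDeBoor` closes a knot span on the right. -/
structure IsKnotSequence (t : ℕ → ℝ) : Prop where
  mono : Monotone t
  le_one : ∀ i, t i ≤ 1

/-- `x` lies in the nonempty `μ`-th knot span `[t μ, t (μ + 1))` of `t`, or in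
`[t μ, t (μ + 1)]` if this one ends at `1`. -/
structure InKnotSpan (t : ℕ → ℝ) (x : ℝ) (μ : ℕ) : Prop where
  lt : t μ < t (μ + 1)
  mem_Icc : x ∈ Set.Icc (t μ) (t (μ + 1))
  eq_one : x = t (μ + 1) → x = 1

namespace InKnotSpan

variable {t : ℕ → ℝ} {x : ℝ} {μ : ℕ}

theorem coxDeBoor_zero (ht : IsKnotSequence t) (h : InKnotSpan t x μ) (j : ℕ) :
    coxDeBoor t 0 j x = if j = μ then 1 else 0 := by
  have hx : x < t (μ + 1) ∨ x = 1 ∧ t (μ + 1) = 1 := by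
    rcases h.mem_Icc.2.lt_or_eq with hlt | heq
    · exact .inl hlt
    · exact .inr ⟨h.eq_one heq, heq ▸ h.eq_one heq⟩
  have hle := ht.le_one
  rw [coxDeBoor]
  refine if_congr ⟨fun hj => ?_, ?_⟩ rfl rfl
  · have h₁ : t j < t (μ + 1) := by grind
    have h₂ : t μ < t (j + 1) := by grind [h.lt, h.mem_Icc.1]
    exact le_antisymm (Nat.lt_succ_iff.1 (ht.mono.reflect_lt h₁))
      (Nat.lt_succ_iff.1 (ht.mono.reflect_lt h₂))
  · rintro rfl
    rcases hx with hlt | ⟨hx, hone⟩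
    · exact .inl ⟨h.mem_Icc.1, hlt⟩
    · exact .inr ⟨h.lt, hone, hx⟩

theorem coxDeBoor_eq_zero (ht : IsKnotSequence t) (h : InKnotSpan t x μ) {q j : ℕ}
    (hj : μ < j ∨ j + q < μ) : coxDeBoor t q j x = 0 := by
  induction q generalizing j with
  | zero => rw [h.coxDeBoor_zero ht, if_neg (by omega)]
  | succ q ih => rw [coxDeBoor, ih (by omega), ih (by omega), mul_zero, mul_zero, add_zero]

theorem coxDeBoor_eq_zero_of_eq (ht : IsKnotSequence t) (h : InKnotSpan t x μ) {q j : ℕ}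
    (hx : x = t j) (hq : μ < j + q) : coxDeBoor t q j x = 0 := by
  induction q generalizing j with
  | zero => exact h.coxDeBoor_eq_zero ht (.inl hq)
  | succ q ih =>
    have hnext : coxDeBoor t q (j + 1) x = 0 := by
      rcases lt_or_ge μ (j + 1) with hμ | hμ
      · exact h.coxDeBoor_eq_zero ht (.inl hμ)
      · refine ih (le_antisymm ?_ ?_) (by omega)
        · exact hx ▸ ht.mono j.le_succ
        · exact (ht.mono hμ).trans h.mem_Icc.1
    rw [coxDeBoor, hx, sub_self, zero_div, zero_mul, zero_add, ← hx, hnext, mul_zero]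

end InKnotSpan

/-- The dual polynomial `∏ (X + (t i - ξ))`, `j < i ≤ j + q`, of the `j`-th B-spline of degree `q`:
its coefficients are, up to binomial factors, the blossoms of the powers of `x - ξ` at the knots
`t (j + 1), …, t (j + q)`. -/
noncomputable def dualPoly (t : ℕ → ℝ) (ξ : ℝ) (q j : ℕ) : ℝ[X] :=
  ∏ i ∈ Finset.Ico (j + 1) (j + q + 1), (X + C (t i - ξ))

theorem dualPoly_succ_right (t : ℕ → ℝ) (ξ : ℝ) (q j : ℕ) :
    dualPoly t ξ (q + 1) j = dualPoly t ξ q j * (X + C (t (j + q + 1) - ξ)) :=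
  Finset.prod_Ico_succ_top (by omega) _

theorem dualPoly_succ_left (t : ℕ → ℝ) (ξ : ℝ) (q j : ℕ) :
    dualPoly t ξ (q + 1) j = (X + C (t (j + 1) - ξ)) * dualPoly t ξ q (j + 1) := by
  rw [dualPoly, Finset.prod_eq_prod_Ico_succ_bot (by omega), dualPoly,
    show j + 1 + q + 1 = j + (q + 1) + 1 by omega]

theorem X_add_C_eq_interpolation {a b : ℝ} (hab : a ≠ b) (x ξ : ℝ) :
    C ((x - a) / (b - a)) * (X + C (b - ξ)) + C ((b - x) / (b - a)) * (X + C (a - ξ)) =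
      X + C (x - ξ) := by
  have hba : b - a ≠ 0 := sub_ne_zero.2 hab.symm
  have hone : (x - a) / (b - a) + (b - x) / (b - a) = 1 := by field_simp; ring
  have hconst : (x - a) / (b - a) * (b - ξ) + (b - x) / (b - a) * (a - ξ) = x - ξ := by
    field_simp; ring
  calc _ = C ((x - a) / (b - a) + (b - x) / (b - a)) * X +
        C ((x - a) / (b - a) * (b - ξ) + (b - x) / (b - a) * (a - ξ)) := by
        simp only [C_add, C_mul]
        ring
    _ = X + C (x - ξ) := by rw [hone, hconst, C_1, one_mul]

theorem InKnotSpan.marsden {t : ℕ → ℝ} (ht : IsKnotSequence t) {x : ℝ} {μ : ℕ}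
    (h : InKnotSpan t x μ) (ξ : ℝ) {N q : ℕ} (hN : μ < N) (hq : q ≤ μ) :
    ∑ j ∈ Finset.range N, C (coxDeBoor t q j x) * dualPoly t ξ q j = (X + C (x - ξ)) ^ q := by
  induction q with
  | zero => simp [dualPoly, h.coxDeBoor_zero ht, hN]
  | succ q ih =>
    -- The two terms of the recursion, in the order in which they meet at `dualPoly t ξ q j`.
    let f (j : ℕ) : ℝ[X] := C (coxDeBoor t q j x) * dualPoly t ξ q j *
      (C ((x - t j) / (t (j + q + 1) - t j)) * (X + C (t (j + q + 1) - ξ)))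
    let g (j : ℕ) : ℝ[X] := C (coxDeBoor t q j x) * dualPoly t ξ q j *
      (C ((t (j + q + 1) - x) / (t (j + q + 1) - t j)) * (X + C (t j - ξ)))
    have hsplit (j : ℕ) :
        C (coxDeBoor t (q + 1) j x) * dualPoly t ξ (q + 1) j = f j + g (j + 1) := by
      rw [coxDeBoor, C_add, add_mul]
      nth_rewrite 1 [dualPoly_succ_right]
      rw [dualPoly_succ_left, C_mul, C_mul]
      simp only [f, g, show j + 1 + q + 1 = j + q + 2 by omega]
      ring
    have hmerge (j : ℕ) :
        f j + g j = C (coxDeBoor t q j x) * dualPoly t ξ q j * (X + C (x - ξ)) := by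
      by_cases hj : μ < j ∨ j + q < μ
      · simp [f, g, h.coxDeBoor_eq_zero ht hj]
      · have hlt : t j < t (j + q + 1) :=
          (ht.mono (by omega)).trans_lt (h.lt.trans_le (ht.mono (by omega)))
        rw [← mul_add, X_add_C_eq_interpolation hlt.ne]
    have hg : ∑ j ∈ Finset.range N, g (j + 1) = ∑ j ∈ Finset.range N, g j := by
      rw [← sub_eq_zero, ← Finset.sum_sub_distrib, Finset.sum_range_sub]
      simp [g, h.coxDeBoor_eq_zero ht (j := N) (.inl hN),
        h.coxDeBoor_eq_zero ht (q := q) (j := 0) (.inr (by omega))]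
    calc ∑ j ∈ Finset.range N, C (coxDeBoor t (q + 1) j x) * dualPoly t ξ (q + 1) j
        = ∑ j ∈ Finset.range N, (f j + g j) := by
          simp only [hsplit, Finset.sum_add_distrib, hg]
      _ = (X + C (x - ξ)) ^ (q + 1) := by
          simp only [hmerge, ← Finset.sum_mul, ih (by omega), pow_succ]

/-- The coefficient of the `j`-th B-spline of degree `q` in the expansion of `(x - ξ) ^ e`, that is
the value of the blossom of this power at the knots `t (j + 1), …, t (j + q)`. -/
noncomputable def dualCoeff (t : ℕ → ℝ) (q : ℕ) (ξ : ℝ) (e j : ℕ) : ℝ :=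
  (dualPoly t ξ q j).coeff (q - e) / q.choose e

theorem InKnotSpan.sum_dualCoeff {t : ℕ → ℝ} (ht : IsKnotSequence t) {x : ℝ} {μ : ℕ}
    (h : InKnotSpan t x μ) (ξ : ℝ) {N q e : ℕ} (hN : μ < N) (hq : q ≤ μ) (he : e ≤ q) :
    ∑ j ∈ Finset.range N, dualCoeff t q ξ e j * coxDeBoor t q j x = (x - ξ) ^ e := by
  have hcoeff := congrArg (fun f : ℝ[X] => f.coeff (q - e)) (h.marsden ht ξ hN hq)
  simp only [finsetSum_coeff, coeff_C_mul, coeff_X_add_C_pow, Nat.choose_symm he,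
    Nat.sub_sub_self he] at hcoeff
  have hchoose : (q.choose e : ℝ) ≠ 0 := by exact_mod_cast (Nat.choose_pos he).ne'
  rw [← mul_div_cancel_right₀ ((x - ξ) ^ e) hchoose, ← hcoeff, Finset.sum_div]
  exact Finset.sum_congr rfl fun j _ => by rw [dualCoeff]; ring

theorem dualCoeff_eq_zero {t : ℕ → ℝ} {ξ : ℝ} {q e j u : ℕ} (he : e ≤ q) (hju : j < u)
    (huj : u ≤ j + e) (hu : ∀ i ∈ Finset.Icc u (u + q - e), t i = ξ) :
    dualCoeff t q ξ e j = 0 := by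
  have hdvd : X ^ (q - e + 1) ∣ dualPoly t ξ q j := by
    have hprod : ∏ i ∈ Finset.Icc u (u + q - e), (X + C (t i - ξ)) = X ^ (q - e + 1) := by
      rw [Finset.prod_congr rfl fun i hi => by rw [hu i hi, sub_self, C_0, add_zero],
        Finset.prod_const, Nat.card_Icc, show u + q - e + 1 - u = q - e + 1 by omega]
    rw [← hprod]
    refine Finset.prod_dvd_prod_of_subset _ _ _ fun i hi => ?_
    rw [Finset.mem_Icc] at hi
    rw [Finset.mem_Ico]
    omega
  rw [dualCoeff, X_pow_dvd_iff.1 hdvd _ (Nat.lt_succ_self _), zero_div]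

/-! ### Open uniform knots -/

/-- The mesh point `a / (k + 1)`, where `a` may exceed `k + 1`. -/
noncomputable def breakpoint (k a : ℕ) : ℝ := a / (k + 1)

theorem breakpoint_zero (k : ℕ) : breakpoint k 0 = 0 := by simp [breakpoint]

theorem breakpoint_last (k : ℕ) : breakpoint k (k + 1) = 1 := by
  rw [breakpoint, Nat.cast_succ]
  exact div_self k.cast_add_one_ne_zero

theorem breakpoint_strictMono (k : ℕ) : StrictMono (breakpoint k) := fun a b hab => by
  unfold breakpoint
  gcongr

theorem breakpoint_nonneg (k a : ℕ) : 0 ≤ breakpoint k a := by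
  unfold breakpoint
  positivity

theorem breakpoint_le_one {k a : ℕ} (ha : a ≤ k + 1) : breakpoint k a ≤ 1 :=
  breakpoint_last k ▸ (breakpoint_strictMono k).monotone ha

theorem exists_inKnotSpan_breakpoint (k : ℕ) (x : unitInterval) :
    ∃ b ≤ k, InKnotSpan (breakpoint k) x b := by
  classical
  set b := Nat.findGreatest (fun b => breakpoint k b ≤ x) k with hb
  have hbk : b ≤ k := Nat.findGreatest_le k
  have hle : breakpoint k b ≤ x :=
    Nat.findGreatest_spec (P := fun b => breakpoint k b ≤ x) k.zero_le
      (by simpa only [breakpoint_zero] using x.2.1)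
  have hlt : breakpoint k b < breakpoint k (b + 1) := breakpoint_strictMono k b.lt_succ_self
  rcases hbk.lt_or_eq with hb' | hb'
  · have hx : (x : ℝ) < breakpoint k (b + 1) :=
      not_le.1 (Nat.findGreatest_is_greatest (hb ▸ b.lt_succ_self) hb')
    exact ⟨b, hbk, hlt, ⟨hle, hx.le⟩, fun h => absurd h hx.ne⟩
  · have hlast : breakpoint k (b + 1) = 1 := by rw [hb', breakpoint_last]
    exact ⟨b, hbk, hlt, ⟨hle, x.2.2.trans_eq hlast.symm⟩, fun h => h.trans hlast⟩

theorem knot_eq_breakpoint {k p r i a : ℕ} (ha : a ≤ k + 1)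
    (hi : i ∈ Set.Ioc (r + a * (p - r)) (p + a * (p - r))) : knot k p r i = breakpoint k a := by
  obtain ⟨hi₁, hi₂⟩ := hi
  obtain ⟨d, rfl⟩ := Nat.exists_eq_add_of_le (show r ≤ p by omega)
  rw [Nat.add_sub_cancel_left] at hi₁ hi₂
  rw [knot, Nat.add_sub_cancel_left]
  rcases a with _ | a
  · rw [if_pos (by simpa using hi₂), breakpoint_zero]
  rw [Nat.succ_mul] at hi₁ hi₂
  rw [if_neg (by omega)]
  rcases ha.lt_or_eq with ha | ha
  · have hdiv : (i - (r + d + 1)) / d = a :=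
      Nat.div_eq_of_lt_le (by omega) (by rw [Nat.succ_mul]; omega)
    have hak : (a + 1) * d ≤ k * d := Nat.mul_le_mul_right d (by omega)
    rw [if_pos (by rw [Nat.succ_mul] at hak; omega), hdiv, breakpoint]
  · obtain rfl : a = k := by omega
    rw [if_neg (by omega), breakpoint_last]

theorem isKnotSequence_knot (k p r : ℕ) : IsKnotSequence (knot k p r) := by
  have hle {i : ℕ} (hi : i < p + 1 + k * (p - r)) :
      (((i - (p + 1)) / (p - r) + 1 : ℕ) : ℝ) / (k + 1) ≤ 1 := by
    have hdiv : (i - (p + 1)) / (p - r) ≤ k :=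
      Nat.div_le_of_le_mul (by rw [mul_comm]; omega)
    rw [div_le_one (by positivity)]
    exact_mod_cast Nat.succ_le_succ hdiv
  refine ⟨fun i j hij => ?_, fun i => ?_⟩
  · unfold knot
    split_ifs with hi hj hj' hi' hj hj'
    · exact le_rfl
    · positivity
    · exact zero_le_one
    · omega
    · gcongr
    · exact hle hi'
    · omega
    · omega
    · exact le_rfl
  · unfold knot
    split_ifs with hi hi'
    · exact zero_le_one
    · exact hle hi'
    · exact le_rfl

theorem InKnotSpan.knot {k p r b : ℕ} {x : ℝ} (h : InKnotSpan (breakpoint k) x b) (hr : r < p)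
    (hb : b ≤ k) : InKnotSpan (knot k p r) x (p + b * (p - r)) := by
  have hleft : MixedSpline.knot k p r (p + b * (p - r)) = breakpoint k b :=
    knot_eq_breakpoint (by omega) ⟨by omega, le_rfl⟩
  have hright : MixedSpline.knot k p r (p + b * (p - r) + 1) = breakpoint k (b + 1) :=
    knot_eq_breakpoint (by omega) (by rw [Nat.succ_mul, Set.mem_Ioc]; omega)
  refine ⟨?_, ?_, ?_⟩ <;> rw [hright]
  · exact hleft ▸ h.lt
  · exact hleft ▸ h.mem_Icc
  · exact h.eq_one

theorem InKnotSpan.bspline_eq_zero {k p r b j : ℕ} {x : unitInterval}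
    (h : InKnotSpan (breakpoint k) x b) (hr : r < p) (hb : b ≤ k)
    (hj : j ∉ Set.Icc (b * (p - r)) (p + b * (p - r))) : bspline k p r j x = 0 := by
  refine (h.knot hr hb).coxDeBoor_eq_zero (isKnotSequence_knot k p r) ?_
  rw [Set.mem_Icc] at hj
  omega

/-! ### Truncated powers and the Curry–Schoenberg theorem -/

/-- The truncated power `(x - ξ)₊ ^ e` at `ξ = breakpoint k a`, as a function on `[0,1]`. It is
`1` everywhere if `e = 0`. -/
noncomputable def truncPow (k a e : ℕ) : unitInterval → ℝ :=
  fun x => max (x - breakpoint k a) 0 ^ e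

/-- The truncated power at `ξ = breakpoint k a` that equals `(x - ξ) ^ e` on the left of `ξ` and, if
`0 < e`, vanishes on the right of it. -/
noncomputable def leftTruncPow (k a e : ℕ) : unitInterval → ℝ :=
  fun x => min (x - breakpoint k a) 0 ^ e

namespace InKnotSpan

variable {k p r a b e : ℕ} {x : unitInterval}

theorem breakpoint_le (h : InKnotSpan (breakpoint k) x b) (hab : a ≤ b) :
    breakpoint k a ≤ x :=
  ((breakpoint_strictMono k).monotone hab).trans h.mem_Icc.1

theorem le_breakpoint (h : InKnotSpan (breakpoint k) x b) (hab : b < a) :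
    x ≤ breakpoint k a :=
  h.mem_Icc.2.trans ((breakpoint_strictMono k).monotone hab)

theorem truncPow_eq_pow (h : InKnotSpan (breakpoint k) x b) (hab : a ≤ b) :
    truncPow k a e x = (x - breakpoint k a) ^ e := by
  rw [truncPow, max_eq_left (sub_nonneg.2 (h.breakpoint_le hab))]

theorem truncPow_eq_zero (h : InKnotSpan (breakpoint k) x b) (hab : b < a) (he : e ≠ 0) :
    truncPow k a e x = 0 := by
  rw [truncPow, max_eq_right (sub_nonpos.2 (h.le_breakpoint hab)), zero_pow he]

theorem leftTruncPow_eq_pow (h : InKnotSpan (breakpoint k) x b) (hab : b < a) :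
    leftTruncPow k a e x = (x - breakpoint k a) ^ e := by
  rw [leftTruncPow, min_eq_left (sub_nonpos.2 (h.le_breakpoint hab))]

theorem leftTruncPow_eq_zero (h : InKnotSpan (breakpoint k) x b) (hab : a ≤ b) (he : e ≠ 0) :
    leftTruncPow k a e x = 0 := by
  rw [leftTruncPow, min_eq_right (sub_nonneg.2 (h.breakpoint_le hab)), zero_pow he]

theorem sum_dualCoeff_bspline (h : InKnotSpan (breakpoint k) x b) (hr : r < p) (hb : b ≤ k)
    (he : e ≤ p) (ξ : ℝ) {J : Finset ℕ} (hJ : J ⊆ Finset.range (numBSplines k p r))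
    (hzero : ∀ j ∈ Set.Icc (b * (p - r)) (p + b * (p - r)), j ∉ J →
      dualCoeff (MixedSpline.knot k p r) p ξ e j = 0) :
    ∑ j ∈ J, dualCoeff (MixedSpline.knot k p r) p ξ e j * bspline k p r j x = (x - ξ) ^ e := by
  have hbk : b * (p - r) ≤ k * (p - r) := Nat.mul_le_mul_right _ hb
  rw [← (h.knot hr hb).sum_dualCoeff (isKnotSequence_knot k p r) ξ (N := numBSplines k p r)
    (by unfold numBSplines; omega) (Nat.le_add_right _ _) he]
  refine Finset.sum_subset hJ fun j _ hj => ?_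
  by_cases hjb : j ∈ Set.Icc (b * (p - r)) (p + b * (p - r))
  · rw [hzero j hjb hj, zero_mul]
  · rw [h.bspline_eq_zero hr hb hjb, mul_zero]

end InKnotSpan

section Spline

variable {k p r a e : ℕ}

theorem dualCoeff_knot_eq_zero {j : ℕ} (ha : a ≤ k + 1) (he : e ≤ p)
    (hj : j < a * (p - r) + e) (hae : a = 0 ∨ r < e ∧ r + a * (p - r) < j + e) :
    dualCoeff (knot k p r) p (breakpoint k a) e j = 0 := by
  rcases hae with rfl | ⟨hre, hje⟩
  · refine dualCoeff_eq_zero (u := j + 1) he j.lt_succ_self (by omega) fun i hi => ?_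
    rw [Finset.mem_Icc] at hi
    rw [knot, if_pos (by omega), breakpoint_zero]
  · refine dualCoeff_eq_zero (u := max (j + 1) (r + a * (p - r) + 1)) he (by omega) (by omega)
      fun i hi => knot_eq_breakpoint ha ?_
    rw [Finset.mem_Icc] at hi
    rw [Set.mem_Ioc]
    omega

theorem sum_dualCoeff_bspline_eq_truncPow (hr : r < p) (ha : a ≤ k) (he : e ≤ p)
    (hae : a = 0 ∨ r < e) :
    ∑ j ∈ Finset.Ico (a * (p - r) + e) (numBSplines k p r),
        dualCoeff (knot k p r) p (breakpoint k a) e j • bspline k p r j = truncPow k a e := by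
  ext x
  obtain ⟨b, hb, h⟩ := exists_inKnotSpan_breakpoint k x
  simp only [Finset.sum_apply, Pi.smul_apply, smul_eq_mul]
  rcases le_or_gt a b with hab | hab
  · have hab' : a * (p - r) ≤ b * (p - r) := Nat.mul_le_mul_right _ hab
    have hbk : b * (p - r) ≤ k * (p - r) := Nat.mul_le_mul_right _ hb
    rw [h.truncPow_eq_pow hab]
    refine h.sum_dualCoeff_bspline hr hb he _ (fun j hj => ?_) fun j hjb hj => ?_
    · exact Finset.mem_range.2 (Finset.mem_Ico.1 hj).2
    · rw [Set.mem_Icc] at hjb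
      rw [Finset.mem_Ico, numBSplines] at hj
      exact dualCoeff_knot_eq_zero (by omega) he (by omega) (by omega)
  · have hba : (b + 1) * (p - r) ≤ a * (p - r) := Nat.mul_le_mul_right _ hab
    rw [Nat.succ_mul] at hba
    rw [h.truncPow_eq_zero hab (by omega)]
    refine Finset.sum_eq_zero fun j hj => ?_
    rw [Finset.mem_Ico] at hj
    rw [h.bspline_eq_zero hr hb (by rw [Set.mem_Icc]; omega), mul_zero]

theorem sum_dualCoeff_bspline_eq_leftTruncPow (ha : a ≤ k + 1) (he : e ∈ Set.Ioc r p) :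
    ∑ j ∈ Finset.range (r + a * (p - r) + 1 - e),
        dualCoeff (knot k p r) p (breakpoint k a) e j • bspline k p r j = leftTruncPow k a e := by
  obtain ⟨hre, hep⟩ := he
  have hr : r < p := hre.trans_le hep
  ext x
  obtain ⟨b, hb, h⟩ := exists_inKnotSpan_breakpoint k x
  simp only [Finset.sum_apply, Pi.smul_apply, smul_eq_mul]
  rcases lt_or_ge b a with hab | hab
  · have hba : (b + 1) * (p - r) ≤ a * (p - r) := Nat.mul_le_mul_right _ hab
    have hak : a * (p - r) ≤ (k + 1) * (p - r) := Nat.mul_le_mul_right _ ha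
    rw [Nat.succ_mul] at hba hak
    rw [h.leftTruncPow_eq_pow hab]
    refine h.sum_dualCoeff_bspline hr hb hep _ (fun j hj => ?_) fun j hjb hj => ?_
    · rw [Finset.mem_range] at hj
      rw [Finset.mem_range, numBSplines]
      omega
    · rw [Set.mem_Icc] at hjb
      rw [Finset.mem_range] at hj
      exact dualCoeff_knot_eq_zero ha hep (by omega) (by omega)
  · have hab' : a * (p - r) ≤ b * (p - r) := Nat.mul_le_mul_right _ hab
    rw [h.leftTruncPow_eq_zero hab (by omega)]
    refine Finset.sum_eq_zero fun j hj => ?_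
    rw [Finset.mem_range] at hj
    rw [h.bspline_eq_zero hr hb (by rw [Set.mem_Icc]; omega), mul_zero]

/-- The pairs `(a, e)` of a mesh point and an exponent for which the truncated powers
`truncPow k a e` form a basis of the spline space of degree `p` and regularity `r`. -/
def truncPowIdx (k p r : ℕ) : Finset (Σ _ : ℕ, ℕ) :=
  (Finset.range (k + 1)).sigma fun a => if a = 0 then Finset.range (p + 1) else Finset.Ioc r p

theorem mem_truncPowIdx {i : Σ _ : ℕ, ℕ} :
    i ∈ truncPowIdx k p r ↔ i.1 ≤ k ∧ i.2 ≤ p ∧ (i.1 = 0 ∨ r < i.2) := by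
  rw [truncPowIdx, Finset.mem_sigma, Finset.mem_range, Nat.lt_succ_iff]
  split_ifs with h <;> simp [h, and_comm]

theorem card_truncPowIdx (k p r : ℕ) : (truncPowIdx k p r).card = numBSplines k p r := by
  simp [truncPowIdx, numBSplines, Finset.sum_range_succ', add_comm]

theorem truncPow_mem_splineSpace (hr : r < p) (ha : a ≤ k) (he : e ≤ p) (hae : a = 0 ∨ r < e) :
    truncPow k a e ∈ splineSpace k p r := by
  rw [← sum_dualCoeff_bspline_eq_truncPow hr ha he hae]
  exact Submodule.sum_mem _ fun j hj => Submodule.smul_mem _ _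
    (Submodule.subset_span ⟨j, (Finset.mem_Ico.1 hj).2, rfl⟩)

end Spline

theorem eq_zero_of_sum_mul_sub_pow_eq_zero {S : Set ℝ} (hS : S.Infinite) (ξ : ℝ) {E : Finset ℕ}
    {c : ℕ → ℝ} (h : ∀ x ∈ S, ∑ e ∈ E, c e * (x - ξ) ^ e = 0) {e : ℕ} (he : e ∈ E) : c e = 0 := by
  have hzero : ∑ e ∈ E, monomial e (c e) = 0 := by
    refine eq_zero_of_infinite_isRoot _ ((hS.image (sub_left_injective (b := ξ)).injOn).mono ?_)
    rintro _ ⟨x, hx, rfl⟩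
    simpa [IsRoot, eval_finsetSum] using h x hx
  have hcoeff := congrArg (fun f => Polynomial.coeff f e) hzero
  simpa [finsetSum_coeff, coeff_monomial, he] using hcoeff

theorem linearIndepOn_truncPow (k p r : ℕ) :
    LinearIndepOn ℝ (fun i : Σ _ : ℕ, ℕ => truncPow k i.1 i.2) (truncPowIdx k p r) := by
  rw [linearIndepOn_finset_iff]
  intro c hc
  rw [truncPowIdx, Finset.sum_sigma] at hc
  suffices ∀ a e, ⟨a, e⟩ ∈ truncPowIdx k p r → c ⟨a, e⟩ = 0 from fun i => this i.1 i.2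
  intro a
  induction a using Nat.strong_induction_on with
  | _ a ih =>
    intro e hae
    have hak : a ≤ k := (mem_truncPowIdx.1 hae).1
    refine eq_zero_of_sum_mul_sub_pow_eq_zero (c := fun e => c ⟨a, e⟩)
      (Set.Ioo_infinite (breakpoint_strictMono k a.lt_succ_self)) (breakpoint k a)
      (fun x hx => ?_) (Finset.mem_sigma.1 hae).2
    have hx01 : x ∈ Set.Icc 0 1 := ⟨(breakpoint_nonneg k a).trans hx.1.le,
      hx.2.le.trans (breakpoint_le_one (Nat.succ_le_succ hak))⟩
    have h : InKnotSpan (breakpoint k) (⟨x, hx01⟩ : unitInterval) a :=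
      ⟨hx.1.trans hx.2, Set.Ioo_subset_Icc_self hx, fun hx' => absurd hx' hx.2.ne⟩
    have hsum := congrFun hc ⟨x, hx01⟩
    rw [Finset.sum_apply, Finset.sum_eq_single a] at hsum
    · simpa [h.truncPow_eq_pow le_rfl] using hsum
    · intro a' ha' hne
      rw [Finset.sum_apply]
      refine Finset.sum_eq_zero fun e he => ?_
      have hmem : ⟨a', e⟩ ∈ truncPowIdx k p r := Finset.mem_sigma.2 ⟨ha', he⟩
      rcases hne.lt_or_gt with hlt | hgt
      · rw [ih a' hlt e hmem, zero_smul, Pi.zero_apply]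
      · have he₀ : e ≠ 0 := by have := (mem_truncPowIdx.1 hmem).2.2; simp only at this; omega
        rw [Pi.smul_apply, h.truncPow_eq_zero hgt he₀, smul_zero]
    · exact fun hnot => absurd (Finset.mem_range.2 (Nat.lt_succ_of_le hak)) hnot

theorem finrank_span_truncPow (k p r : ℕ) :
    Module.finrank ℝ (Submodule.span ℝ
      ((fun i : Σ _ : ℕ, ℕ => truncPow k i.1 i.2) '' truncPowIdx k p r)) = numBSplines k p r := by
  rw [Set.image_eq_range, ← card_truncPowIdx, ← Fintype.card_coe]
  exact finrank_span_eq_card (linearIndepOn_truncPow k p r)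

instance finiteDimensional_splineSpace (k p r : ℕ) : FiniteDimensional ℝ (splineSpace k p r) :=
  FiniteDimensional.span_of_finite ℝ ((Set.finite_Iio _).image _)

theorem span_truncPow_eq_splineSpace {k p r : ℕ} (hr : r < p) :
    Submodule.span ℝ ((fun i : Σ _ : ℕ, ℕ => truncPow k i.1 i.2) '' truncPowIdx k p r) =
      splineSpace k p r := by
  refine Submodule.eq_of_le_of_finrank_le (Submodule.span_le.2 ?_) ?_
  · rintro _ ⟨i, hi, rfl⟩
    obtain ⟨ha, he, hae⟩ := mem_truncPowIdx.1 hi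
    exact truncPow_mem_splineSpace hr ha he hae
  · rw [finrank_span_truncPow, splineSpace, Set.image_eq_range]
    simpa [Set.finrank] using finrank_range_le_card (R := ℝ)
      (fun j : Set.Iio (numBSplines k p r) => bspline k p r j)

theorem linearIndepOn_bspline {k p r : ℕ} (hr : r < p) :
    LinearIndepOn ℝ (bspline k p r) (Set.Iio (numBSplines k p r)) := by
  rw [LinearIndepOn, linearIndependent_iff_card_eq_finrank_span, Set.finrank,
    ← Set.image_eq_range, ← splineSpace, ← span_truncPow_eq_splineSpace hr,
    finrank_span_truncPow, Fintype.card_Iio, Nat.card_Iio]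

theorem splineSpace_mono {k p₁ r₁ p₂ r₂ : ℕ} (hr₁ : r₁ < p₁) (hr : r₂ ≤ r₁) (hp : p₁ ≤ p₂) :
    splineSpace k p₁ r₁ ≤ splineSpace k p₂ r₂ := by
  rw [← span_truncPow_eq_splineSpace hr₁,
    ← span_truncPow_eq_splineSpace (hr.trans_lt (hr₁.trans_le hp))]
  refine Submodule.span_mono (Set.image_mono fun i hi => ?_)
  simp only [Finset.mem_coe, mem_truncPowIdx] at hi ⊢
  omega

theorem bspline_mem_splineSpace {k p r j : ℕ} (hj : j < numBSplines k p r) :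
    bspline k p r j ∈ splineSpace k p r :=
  Submodule.subset_span ⟨j, hj, rfl⟩

/-! ### Boundary splines and truncation -/

/-- The span of the B-splines whose index is outer; these are the only ones that truncation
removes. -/
noncomputable def outerSpace (s k p r : ℕ) : Submodule ℝ (unitInterval → ℝ) :=
  Submodule.span ℝ (bspline k p r '' outerIdx s (numBSplines k p r))

/-- The span of the B-splines whose index is inner, a complement of `outerSpace` in the spline
space if `s` is less than the number of B-splines. -/
noncomputable def innerSpace (s k p r : ℕ) : Submodule ℝ (unitInterval → ℝ) :=
  Submodule.span ℝ (bspline k p r '' innerIdx s (numBSplines k p r))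

theorem outerIdx_subset_Iio {s n : ℕ} (hs : s < n) : outerIdx s n ⊆ Set.Iio n := by
  intro j
  simp only [outerIdx, Set.mem_union, Set.mem_Icc, Set.mem_Iio]
  omega

theorem innerIdx_subset_Iio (s n : ℕ) : innerIdx s n ⊆ Set.Iio n := by
  intro j
  simp only [innerIdx, Set.mem_Icc, Set.mem_Iio]
  omega

theorem disjoint_innerIdx_outerIdx (s n : ℕ) : Disjoint (innerIdx s n) (outerIdx s n) := by
  rw [Set.disjoint_left]
  intro j
  simp only [innerIdx, outerIdx, Set.mem_union, Set.mem_Icc]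
  omega

theorem disjoint_innerSpace_outerSpace {s k p r : ℕ} (hr : r < p) (hs : s < numBSplines k p r) :
    Disjoint (innerSpace s k p r) (outerSpace s k p r) :=
  ((linearIndepOn_union_iff (disjoint_innerIdx_outerIdx s _)).1
    ((linearIndepOn_bspline hr).mono
      (Set.union_subset (innerIdx_subset_Iio s _) (outerIdx_subset_Iio hs)))).2.2

theorem leftTruncPow_one_ne_zero (k e : ℕ) : leftTruncPow k 1 e ≠ 0 := by
  have hpos : 0 < breakpoint k 1 := breakpoint_zero k ▸ breakpoint_strictMono k zero_lt_one
  intro h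
  have h0 := congrFun h 0
  rw [leftTruncPow, Set.Icc.coe_zero, zero_sub, min_eq_left (neg_nonpos.2 hpos.le)] at h0
  exact pow_ne_zero e (neg_ne_zero.2 hpos.ne') h0

theorem truncPow_last_ne_zero (k e : ℕ) : truncPow k k e ≠ 0 := by
  have hlt : breakpoint k k < 1 := breakpoint_last k ▸ breakpoint_strictMono k k.lt_succ_self
  intro h
  have h1 := congrFun h 1
  rw [truncPow, Set.Icc.coe_one, max_eq_left (sub_nonneg.2 hlt.le)] at h1
  exact pow_ne_zero e (sub_ne_zero.2 hlt.ne') h1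

section Truncation

variable {s k p₁ r₁ p₂ r₂ : ℕ}

theorem bspline_zero_mem_outerSpace (hr₁ : r₁ < p₁) (hr : r₂ ≤ r₁) (hp : p₁ ≤ p₂)
    (hp' : p₂ ≤ p₁ + s) : bspline k p₁ r₁ 0 ∈ outerSpace s k p₂ r₂ := by
  have hlow := sum_dualCoeff_bspline_eq_leftTruncPow (k := k) (a := 1) (by omega) ⟨hr₁, le_rfl⟩
  have hhigh := sum_dualCoeff_bspline_eq_leftTruncPow (k := k) (a := 1) (r := r₂) (by omega)
    ⟨hr.trans_lt hr₁, hp⟩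
  rw [show r₁ + 1 * (p₁ - r₁) + 1 - p₁ = 1 by omega, Finset.sum_range_one] at hlow
  rw [← Submodule.smul_mem_iff _
    (left_ne_zero_of_smul (hlow.trans_ne (leftTruncPow_one_ne_zero k p₁))), hlow, ← hhigh]
  refine Submodule.sum_mem _ fun j hj => Submodule.smul_mem _ _ (Submodule.subset_span ⟨j, ?_, rfl⟩)
  rw [Finset.mem_range] at hj
  exact .inl ⟨j.zero_le, by omega⟩

theorem bspline_last_mem_outerSpace (hr₁ : r₁ < p₁) (hr : r₂ ≤ r₁) (hp : p₁ ≤ p₂)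
    (hp' : p₂ ≤ p₁ + s) :
    bspline k p₁ r₁ (numBSplines k p₁ r₁ - 1) ∈ outerSpace s k p₂ r₂ := by
  have hlow := sum_dualCoeff_bspline_eq_truncPow hr₁ (le_refl k) le_rfl (.inr hr₁)
  have hhigh := sum_dualCoeff_bspline_eq_truncPow (hr.trans_lt (hr₁.trans_le hp)) (le_refl k) hp
    (.inr (hr.trans_lt hr₁))
  have hn : numBSplines k p₁ r₁ = k * (p₁ - r₁) + p₁ + 1 := by unfold numBSplines; omega
  rw [hn, Nat.Ico_succ_singleton, Finset.sum_singleton] at hlow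
  rw [hn, Nat.add_sub_cancel, ← Submodule.smul_mem_iff _
    (left_ne_zero_of_smul (hlow.trans_ne (truncPow_last_ne_zero k p₁))), hlow, ← hhigh]
  refine Submodule.sum_mem _ fun j hj => Submodule.smul_mem _ _ (Submodule.subset_span ⟨j, ?_, rfl⟩)
  rw [Finset.mem_Ico, numBSplines] at hj
  refine .inr ?_
  rw [numBSplines, Set.mem_Icc]
  omega

theorem coeff_spec {i : ℕ} (h : bspline k p₁ r₁ i ∈ splineSpace k p₂ r₂) :
    bspline k p₁ r₁ i = ∑ j, coeff k p₁ r₁ p₂ r₂ i j • bspline k p₂ r₂ j := by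
  refine Classical.epsilon_spec (p := fun μ : Fin (numBSplines k p₂ r₂) → ℝ =>
    bspline k p₁ r₁ i = ∑ j, μ j • bspline k p₂ r₂ j) ?_
  have hspan : splineSpace k p₂ r₂ = Submodule.span ℝ
      (Set.range fun j : Fin (numBSplines k p₂ r₂) => bspline k p₂ r₂ j) := by
    rw [splineSpace, ← Fin.range_val, ← Set.range_comp, Function.comp_def]
  rw [hspan, Submodule.mem_span_range_iff_exists_fun] at h
  exact h.imp fun _ => Eq.symm

theorem bspline_sub_truncBSpline_mem_outerSpace {i : ℕ}
    (h : bspline k p₁ r₁ i ∈ splineSpace k p₂ r₂) :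
    bspline k p₁ r₁ i - truncBSpline s k p₁ r₁ p₂ r₂ i ∈ outerSpace s k p₂ r₂ := by
  have hcompl := Finset.sum_filter_add_sum_filter_not Finset.univ
    (fun j : Fin (numBSplines k p₂ r₂) => s + 1 ≤ (j : ℕ) ∧ (j : ℕ) ≤ numBSplines k p₂ r₂ - s - 2)
    (fun j => coeff k p₁ r₁ p₂ r₂ i j • bspline k p₂ r₂ j)
  rw [truncBSpline, coeff_spec h, ← hcompl, add_sub_cancel_left]
  refine Submodule.sum_mem _ fun j hj => Submodule.smul_mem _ _ (Submodule.subset_span ⟨j, ?_, rfl⟩)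
  have hj' := (Finset.mem_filter.1 hj).2
  simp only [outerIdx, Set.mem_union, Set.mem_Icc]
  omega

theorem truncBSpline_mem_innerSpace (i : ℕ) :
    truncBSpline s k p₁ r₁ p₂ r₂ i ∈ innerSpace s k p₂ r₂ :=
  Submodule.sum_mem _ fun j hj => Submodule.smul_mem _ _
    (Submodule.subset_span ⟨j, (Finset.mem_filter.1 hj).2, rfl⟩)

theorem outerSpace_le_splineSpace {p r : ℕ} (hs : s < numBSplines k p r) :
    outerSpace s k p r ≤ splineSpace k p r :=
  Submodule.span_mono (Set.image_mono (outerIdx_subset_Iio hs))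

theorem innerSpace_le_splineSpace (s k p r : ℕ) : innerSpace s k p r ≤ splineSpace k p r :=
  Submodule.span_mono (Set.image_mono (innerIdx_subset_Iio s _))

theorem truncBSpline_eq_zero {i : ℕ} (hr₂ : r₂ < p₂) (hs : s < numBSplines k p₂ r₂)
    (hi : bspline k p₁ r₁ i ∈ outerSpace s k p₂ r₂) : truncBSpline s k p₁ r₁ p₂ r₂ i = 0 := by
  refine Submodule.disjoint_def.1 (disjoint_innerSpace_outerSpace hr₂ hs) _
    (truncBSpline_mem_innerSpace i) ?_
  have hsub := bspline_sub_truncBSpline_mem_outerSpace (s := s) (outerSpace_le_splineSpace hs hi)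
  simpa only [sub_sub_cancel] using Submodule.sub_mem _ hi hsub

end Truncation

/-! ### Tensor products -/

/-- `tensorFun` as a bilinear map, so that spans of products become images under
`Submodule.map₂`. -/
noncomputable def tensorBilin :
    (unitInterval → ℝ) →ₗ[ℝ] (unitInterval → ℝ) →ₗ[ℝ] unitInterval × unitInterval → ℝ :=
  LinearMap.mk₂ ℝ tensorFun
    (fun _ _ _ => funext fun _ => add_mul _ _ _) (fun _ _ _ => funext fun _ => mul_assoc _ _ _)
    (fun _ _ _ => funext fun _ => mul_add _ _ _)
    (fun _ _ _ => funext fun _ => mul_left_comm _ _ _)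

theorem prodSpan_eq_map₂ (N : ℕ → unitInterval → ℝ) (A B : Set ℕ) :
    prodSpan N A B =
      Submodule.map₂ tensorBilin (Submodule.span ℝ (N '' A)) (Submodule.span ℝ (N '' B)) := by
  rw [Submodule.map₂_span_span, Set.image2_image_left, Set.image2_image_right]
  rfl

theorem tensorSplineSpace_eq_prodSpan (k p r : ℕ) :
    tensorSplineSpace k p r =
      prodSpan (bspline k p r) (Set.Iio (numBSplines k p r)) (Set.Iio (numBSplines k p r)) := by
  have hmap := Submodule.map₂_span_span ℝ tensorBilin (splineSpace k p r : Set (unitInterval → ℝ))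
    (splineSpace k p r)
  rw [Submodule.span_eq] at hmap
  rw [prodSpan_eq_map₂]
  exact hmap.symm

theorem tensorFun_mem_prodSpan {N : ℕ → unitInterval → ℝ} {A B : Set ℕ} {f g : unitInterval → ℝ}
    (hf : f ∈ Submodule.span ℝ (N '' A)) (hg : g ∈ Submodule.span ℝ (N '' B)) :
    tensorFun f g ∈ prodSpan N A B := by
  rw [prodSpan_eq_map₂]
  exact Submodule.apply_mem_map₂ tensorBilin hf hg

theorem prodSpan_le_tensorSplineSpace {k p r : ℕ} {N : ℕ → unitInterval → ℝ} {A B : Set ℕ}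
    (hA : ∀ j ∈ A, N j ∈ splineSpace k p r) (hB : ∀ j ∈ B, N j ∈ splineSpace k p r) :
    prodSpan N A B ≤ tensorSplineSpace k p r := by
  refine Submodule.span_mono ?_
  rintro _ ⟨i, hi, j, hj, rfl⟩
  exact ⟨_, hA i hi, _, hB j hj, rfl⟩

theorem tensorFun_eq_zero {f g : unitInterval → ℝ} (h : f = 0 ∨ g = 0) : tensorFun f g = 0 := by
  ext z
  rcases h with rfl | rfl <;> simp [tensorFun]

theorem tensorFun_sub_tensorFun (f f' g g' : unitInterval → ℝ) :
    tensorFun f g - tensorFun f' g' = tensorFun (f - f') g + tensorFun f' (g - g') := by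
  ext z
  simp only [tensorFun, Pi.add_apply, Pi.sub_apply]
  ring

/-! ### The inclusions -/

section Inclusions

variable {s k p₁ r₁ p₂ r₂ : ℕ}

theorem Icc_zero_numBSplines_sub_one (k p r : ℕ) :
    Set.Icc 0 (numBSplines k p r - 1) = Set.Iio (numBSplines k p r) := by
  ext j
  rw [Set.mem_Icc, Set.mem_Iio, numBSplines]
  omega

theorem tensorFun_outer_mem_highSpace {p r : ℕ} {f g : unitInterval → ℝ}
    (hf : f ∈ outerSpace s k p r) (hg : g ∈ splineSpace k p r) :
    tensorFun f g ∈ highSpace s k p r := by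
  rw [highSpace, Icc_zero_numBSplines_sub_one]
  exact Submodule.mem_sup_left (tensorFun_mem_prodSpan hf hg)

theorem tensorFun_inner_outer_mem_highSpace {p r : ℕ} {f g : unitInterval → ℝ}
    (hf : f ∈ innerSpace s k p r) (hg : g ∈ outerSpace s k p r) :
    tensorFun f g ∈ highSpace s k p r :=
  Submodule.mem_sup_right (tensorFun_mem_prodSpan hf hg)

theorem tensorFun_bspline_sub_mem_highSpace {i j : ℕ}
    (hi : bspline k p₁ r₁ i ∈ splineSpace k p₂ r₂) (hj : bspline k p₁ r₁ j ∈ splineSpace k p₂ r₂) :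
    tensorFun (bspline k p₁ r₁ i) (bspline k p₁ r₁ j) -
        tensorFun (truncBSpline s k p₁ r₁ p₂ r₂ i) (truncBSpline s k p₁ r₁ p₂ r₂ j) ∈
      highSpace s k p₂ r₂ := by
  rw [tensorFun_sub_tensorFun]
  exact Submodule.add_mem _
    (tensorFun_outer_mem_highSpace (bspline_sub_truncBSpline_mem_outerSpace hi) hj)
    (tensorFun_inner_outer_mem_highSpace (truncBSpline_mem_innerSpace i)
      (bspline_sub_truncBSpline_mem_outerSpace hj))

theorem tensorFun_truncBSpline_mem_truncSpace {i j : ℕ}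
    (hi : i ∈ Set.Icc 1 (numBSplines k p₁ r₁ - 2)) (hj : j ∈ Set.Icc 1 (numBSplines k p₁ r₁ - 2))
    (hij : ¬(i ∈ innerIdx s (numBSplines k p₁ r₁) ∧ j ∈ innerIdx s (numBSplines k p₁ r₁))) :
    tensorFun (truncBSpline s k p₁ r₁ p₂ r₂ i) (truncBSpline s k p₁ r₁ p₂ r₂ j) ∈
      truncSpace s k p₁ r₁ p₂ r₂ := by
  have htrunc {l : ℕ} (hl : l ∈ Set.Icc 1 (numBSplines k p₁ r₁ - 2))
      (hl' : l ∉ innerIdx s (numBSplines k p₁ r₁)) : l ∈ truncIdx s (numBSplines k p₁ r₁) := by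
    simp only [innerIdx, truncIdx, Set.mem_union, Set.mem_Icc] at hl hl' ⊢
    omega
  by_cases hi' : i ∈ innerIdx s (numBSplines k p₁ r₁)
  · exact Submodule.mem_sup_right
      (Submodule.subset_span ⟨i, hi', j, htrunc hj fun hj' => hij ⟨hi', hj'⟩, rfl⟩)
  · exact Submodule.mem_sup_left (Submodule.subset_span ⟨i, htrunc hi hi', j, hj, rfl⟩)

theorem tensorSplineSpace_le_mixedSpace (hs : s ≤ p₁) (hr₁ : r₁ < p₁) (hr : r₂ ≤ r₁)
    (hp : p₁ ≤ p₂) (hp' : p₂ ≤ p₁ + s) :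
    tensorSplineSpace k p₁ r₁ ≤ mixedSpace s k p₁ r₁ p₂ r₂ := by
  have hr₂ : r₂ < p₂ := hr.trans_lt (hr₁.trans_le hp)
  have hs₂ : s < numBSplines k p₂ r₂ := by unfold numBSplines; omega
  have hmem {i : ℕ} (hi : i < numBSplines k p₁ r₁) : bspline k p₁ r₁ i ∈ splineSpace k p₂ r₂ :=
    splineSpace_mono hr₁ hr hp (bspline_mem_splineSpace hi)
  have htrunc {i : ℕ} (hi : i < numBSplines k p₁ r₁) :
      truncBSpline s k p₁ r₁ p₂ r₂ i = 0 ∨ i ∈ Set.Icc 1 (numBSplines k p₁ r₁ - 2) := by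
    obtain rfl | rfl | hi' :
        i = 0 ∨ i = numBSplines k p₁ r₁ - 1 ∨ i ∈ Set.Icc 1 (numBSplines k p₁ r₁ - 2) := by
      rw [Set.mem_Icc]; omega
    · exact .inl (truncBSpline_eq_zero hr₂ hs₂ (bspline_zero_mem_outerSpace hr₁ hr hp hp'))
    · exact .inl (truncBSpline_eq_zero hr₂ hs₂ (bspline_last_mem_outerSpace hr₁ hr hp hp'))
    · exact .inr hi'
  rw [tensorSplineSpace_eq_prodSpan, prodSpan, Submodule.span_le]
  rintro _ ⟨i, hi, j, hj, rfl⟩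
  by_cases hij : i ∈ innerIdx s (numBSplines k p₁ r₁) ∧ j ∈ innerIdx s (numBSplines k p₁ r₁)
  · exact Submodule.mem_sup_left
      (Submodule.mem_sup_left (Submodule.subset_span ⟨i, hij.1, j, hij.2, rfl⟩))
  · refine (Submodule.sub_mem_iff_left _ (Submodule.mem_sup_left (Submodule.mem_sup_right ?_))).1
      (Submodule.mem_sup_right (tensorFun_bspline_sub_mem_highSpace (hmem hi) (hmem hj)))
    rcases htrunc hi with hi' | hi'
    · exact tensorFun_eq_zero (.inl hi') ▸ Submodule.zero_mem _
    rcases htrunc hj with hj' | hj'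
    · exact tensorFun_eq_zero (.inr hj') ▸ Submodule.zero_mem _
    exact tensorFun_truncBSpline_mem_truncSpace hi' hj' hij

theorem mixedSpace_le_tensorSplineSpace (hle : splineSpace k p₁ r₁ ≤ splineSpace k p₂ r₂)
    (hs : s < numBSplines k p₂ r₂) :
    mixedSpace s k p₁ r₁ p₂ r₂ ≤ tensorSplineSpace k p₂ r₂ := by
  have hlow (j) (hj : j ∈ innerIdx s (numBSplines k p₁ r₁)) :
      bspline k p₁ r₁ j ∈ splineSpace k p₂ r₂ :=
    hle (bspline_mem_splineSpace (innerIdx_subset_Iio s _ hj))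
  have htrunc (j) : truncBSpline s k p₁ r₁ p₂ r₂ j ∈ splineSpace k p₂ r₂ :=
    innerSpace_le_splineSpace s k p₂ r₂ (truncBSpline_mem_innerSpace j)
  have hinner (j) (hj : j ∈ innerIdx s (numBSplines k p₂ r₂)) :
      bspline k p₂ r₂ j ∈ splineSpace k p₂ r₂ :=
    bspline_mem_splineSpace (innerIdx_subset_Iio s _ hj)
  have houter (j) (hj : j ∈ outerIdx s (numBSplines k p₂ r₂)) :
      bspline k p₂ r₂ j ∈ splineSpace k p₂ r₂ :=
    bspline_mem_splineSpace (outerIdx_subset_Iio hs hj)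
  rw [mixedSpace, highSpace, Icc_zero_numBSplines_sub_one]
  exact sup_le (sup_le (prodSpan_le_tensorSplineSpace hlow hlow)
    (sup_le (prodSpan_le_tensorSplineSpace (fun j _ => htrunc j) fun j _ => htrunc j)
      (prodSpan_le_tensorSplineSpace (fun j _ => htrunc j) fun j _ => htrunc j)))
    (sup_le (prodSpan_le_tensorSplineSpace houter fun _ => bspline_mem_splineSpace)
      (prodSpan_le_tensorSplineSpace hinner houter))

end Inclusions

/-! ### Local reproduction of polynomials -/

section LocalReproduction

variable {k p r a j : ℕ} {x : unitInterval}

theorem bspline_eq_zero_of_mem_meshInterval (hr : r < p) (ha : a ≤ k)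
    (hx : (x : ℝ) ∈ meshInterval k a (a + 1))
    (hj : j ∉ Set.Icc (a * (p - r)) (p + a * (p - r))) : bspline k p r j x = 0 := by
  have hax : breakpoint k a ≤ x := by simpa [breakpoint] using hx.1
  have hxa : x ≤ breakpoint k (a + 1) := by simpa [breakpoint] using hx.2
  have hmono := breakpoint_strictMono k
  obtain ⟨b, hb, h⟩ := exists_inKnotSpan_breakpoint k x
  have hba : b ≤ a + 1 := hmono.le_iff_le.1 (h.mem_Icc.1.trans hxa)
  have hab : a ≤ b := by
    by_contra! hlt
    have hle : breakpoint k (b + 1) ≤ x := (hmono.monotone hlt).trans hax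
    have hlt_one : breakpoint k a < 1 := breakpoint_last k ▸ hmono (Nat.lt_succ_of_le ha)
    have hone := h.eq_one (le_antisymm h.mem_Icc.2 hle)
    exact hlt_one.not_ge (hone ▸ h.le_breakpoint hlt)
  obtain rfl | rfl : b = a ∨ b = a + 1 := by omega
  · exact h.bspline_eq_zero hr hb hj
  -- At the right end point of the cell the B-splines starting there vanish by continuity.
  by_cases hj' : j ∈ Set.Icc ((a + 1) * (p - r)) (p + (a + 1) * (p - r))
  · rw [Set.mem_Icc, Nat.succ_mul] at hj'
    rw [Set.mem_Icc] at hj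
    have hknot : knot k p r j = breakpoint k (a + 1) :=
      knot_eq_breakpoint (by omega) (by rw [Set.mem_Ioc, Nat.succ_mul]; omega)
    exact (h.knot hr hb).coxDeBoor_eq_zero_of_eq (isKnotSequence_knot k p r)
      ((le_antisymm hxa h.mem_Icc.1).trans hknot.symm) (by rw [Nat.succ_mul]; omega)
  · exact h.bspline_eq_zero hr hb hj'

theorem mem_meshInterval_of_bspline_ne_zero (hr : r < p)
    (hj : j ∈ Set.Icc (a * (p - r)) (p + a * (p - r))) (hx : bspline k p r j x ≠ 0) :
    (x : ℝ) ∈ meshInterval k (a - p) (a + 1 + p) := by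
  obtain ⟨b, hb, h⟩ := exists_inKnotSpan_breakpoint k x
  have hjb : j ∈ Set.Icc (b * (p - r)) (p + b * (p - r)) := by
    by_contra hjb
    exact hx (h.bspline_eq_zero hr hb hjb)
  have hd : 0 < p - r := Nat.sub_pos_of_lt hr
  have hle {b c : ℕ} (hbc : b * (p - r) ≤ p + c * (p - r)) : b ≤ c + p := by
    by_contra! hlt
    nlinarith
  have hba : b ≤ a + p := hle (hjb.1.trans hj.2)
  have hab : a ≤ b + p := hle (hj.1.trans hjb.2)
  have hba' : (b : ℝ) ≤ a + p := by exact_mod_cast hba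
  have hab' : (a : ℝ) ≤ b + p := by exact_mod_cast hab
  obtain ⟨hbx, hxb⟩ := h.mem_Icc
  rw [breakpoint] at hbx hxb
  push_cast at hxb
  rw [meshInterval, Set.mem_Icc]
  push_cast
  exact ⟨(div_le_div_of_nonneg_right (by linarith) k.cast_add_one_pos.le).trans hbx,
    hxb.trans (div_le_div_of_nonneg_right (by linarith) k.cast_add_one_pos.le)⟩

end LocalReproduction

theorem exists_eqOn_support_subset_of_mem_span {α : Type*} {S : Set (α → ℝ)}
    {V : Submodule ℝ (α → ℝ)} {Q R : Set α}
    (hS : ∀ f ∈ S, ∃ g ∈ V, Set.EqOn g f Q ∧ Function.support g ⊆ R) {f : α → ℝ}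
    (hf : f ∈ Submodule.span ℝ S) : ∃ g ∈ V, Set.EqOn g f Q ∧ Function.support g ⊆ R := by
  induction hf using Submodule.span_induction with
  | mem f hf => exact hS f hf
  | zero => exact ⟨0, V.zero_mem, Set.eqOn_refl _ _, by simp⟩
  | add f₁ f₂ _ _ ih₁ ih₂ =>
    obtain ⟨g₁, hg₁, heq₁, hsupp₁⟩ := ih₁
    obtain ⟨g₂, hg₂, heq₂, hsupp₂⟩ := ih₂
    exact ⟨g₁ + g₂, V.add_mem hg₁ hg₂, fun z hz => congrArg₂ (· + ·) (heq₁ hz) (heq₂ hz),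
      (Function.support_add g₁ g₂).trans (Set.union_subset hsupp₁ hsupp₂)⟩
  | smul c f _ ih =>
    obtain ⟨g, hg, heq, hsupp⟩ := ih
    exact ⟨c • g, V.smul_mem c hg, fun z hz => congrArg (c * ·) (heq hz),
      (Function.support_const_smul_subset c g).trans hsupp⟩

theorem exists_eqOn_cell_of_mem_tensorSplineSpace {k p r a b : ℕ} (hr : r < p) (ha : a ≤ k)
    (hb : b ≤ k) {f : unitInterval × unitInterval → ℝ} (hf : f ∈ tensorSplineSpace k p r) :
    ∃ g ∈ tensorSplineSpace k p r,
      Set.EqOn g f {z | (z.1 : ℝ) ∈ meshInterval k a (a + 1) ∧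
        (z.2 : ℝ) ∈ meshInterval k b (b + 1)} ∧
      Function.support g ⊆ {z | (z.1 : ℝ) ∈ meshInterval k (a - p) (a + 1 + p) ∧
        (z.2 : ℝ) ∈ meshInterval k (b - p) (b + 1 + p)} := by
  rw [tensorSplineSpace_eq_prodSpan] at hf ⊢
  refine exists_eqOn_support_subset_of_mem_span ?_ hf
  rintro _ ⟨i, hi, j, hj, rfl⟩
  by_cases hij : i ∈ Set.Icc (a * (p - r)) (p + a * (p - r)) ∧
      j ∈ Set.Icc (b * (p - r)) (p + b * (p - r))
  · exact ⟨_, Submodule.subset_span ⟨i, hi, j, hj, rfl⟩, Set.eqOn_refl _ _, fun z hz =>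
      ⟨mem_meshInterval_of_bspline_ne_zero hr hij.1 (left_ne_zero_of_mul hz),
        mem_meshInterval_of_bspline_ne_zero hr hij.2 (right_ne_zero_of_mul hz)⟩⟩
  · refine ⟨0, Submodule.zero_mem _, fun z hz => ?_, by simp⟩
    rcases not_and_or.1 hij with hi' | hj'
    · simp [tensorFun, bspline_eq_zero_of_mem_meshInterval hr ha hz.1 hi']
    · simp [tensorFun, bspline_eq_zero_of_mem_meshInterval hr hb hz.2 hj']

theorem pow_mem_splineSpace {k p r e : ℕ} (hr : r < p) (he : e ≤ p) :
    (fun x : unitInterval => (x : ℝ) ^ e) ∈ splineSpace k p r := by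
  convert truncPow_mem_splineSpace hr k.zero_le he (.inl rfl) using 2 with x
  rw [truncPow, breakpoint_zero, sub_zero, max_eq_left x.2.1]

theorem polyFun_eq_sum (q : MvPolynomial (Fin 2) ℝ) :
    polyFun q = ∑ d ∈ q.support, q.coeff d •
      tensorFun (fun x => (x : ℝ) ^ d 0) (fun y => (y : ℝ) ^ d 1) := by
  ext z
  rw [polyFun, MvPolynomial.eval_eq']
  simp [tensorFun, Fin.prod_univ_two]

theorem polyFun_mem_tensorSplineSpace {k p r : ℕ} (hr : r < p) {q : MvPolynomial (Fin 2) ℝ}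
    (hq : ∀ i, q.degreeOf i ≤ p) : polyFun q ∈ tensorSplineSpace k p r := by
  have hdeg {d} (hd : d ∈ q.support) (i) : d i ≤ p := MvPolynomial.degreeOf_le_iff.1 (hq i) d hd
  rw [polyFun_eq_sum]
  exact Submodule.sum_mem _ fun d hd => Submodule.smul_mem _ _ (Submodule.subset_span
    ⟨_, pow_mem_splineSpace hr (hdeg hd 0), _, pow_mem_splineSpace hr (hdeg hd 1), rfl⟩)

theorem locallyReproduces_tensorSplineSpace {k p r : ℕ} (hr : r < p) :
    LocallyReproduces k p (tensorSplineSpace k p r) := fun _ hq =>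
  have hmem := polyFun_mem_tensorSplineSpace hr hq
  ⟨hmem, fun _ _ ha hb =>
    let ⟨g, hg, heq, hsupp⟩ := exists_eqOn_cell_of_mem_tensorSplineSpace hr ha hb hmem
    ⟨g, hg, fun _ hz₁ hz₂ => heq ⟨hz₁, hz₂⟩, fun _ hz => hsupp hz⟩⟩

theorem LocallyReproduces.mono {k p : ℕ} {V W : Submodule ℝ (unitInterval × unitInterval → ℝ)}
    (h : LocallyReproduces k p V) (hVW : V ≤ W) : LocallyReproduces k p W := fun q hq =>
  ⟨hVW (h q hq).1, fun a b ha hb =>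
    let ⟨f, hf, hf'⟩ := (h q hq).2 a b ha hb
    ⟨f, hVW hf, hf'⟩⟩

end MixedSpline

theorem theorem3_general (s k p₁ r₁ p₂ r₂ : ℕ) (hs : s ≤ p₁) (hr₁ : r₁ < p₁) (hr : r₂ ≤ r₁)
    (hp : p₁ ≤ p₂) (hp' : p₂ ≤ p₁ + s) :
    MixedSpline.tensorSplineSpace k p₁ r₁ ≤ MixedSpline.mixedSpace s k p₁ r₁ p₂ r₂ ∧
    MixedSpline.mixedSpace s k p₁ r₁ p₂ r₂ ≤ MixedSpline.tensorSplineSpace k p₂ r₂ ∧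
    MixedSpline.LocallyReproduces k p₁ (MixedSpline.mixedSpace s k p₁ r₁ p₂ r₂) := by
  have hlow := MixedSpline.tensorSplineSpace_le_mixedSpace (k := k) hs hr₁ hr hp hp'
  have hs₂ : s < MixedSpline.numBSplines k p₂ r₂ := by unfold MixedSpline.numBSplines; omega
  exact ⟨hlow, MixedSpline.mixedSpace_le_tensorSplineSpace
    (MixedSpline.splineSpace_mono hr₁ hr hp) hs₂,
    (MixedSpline.locallyReproduces_tensorSplineSpace hr₁).mono hlow⟩

theorem theorem3 (s k p₁ r₁ p₂ r₂ : ℕ) (hs : 1 ≤ s)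
    (hp₂ : p₂ = 2 * s + 1) (hr₂ : r₂ = s) (hr₁ : r₁ = p₁ - 1)
    (hp₁ : s + 1 ≤ p₁) (hp₁' : p₁ ≤ 2 * s + 1)
    (hk : max (2 * (s + 1) - p₁) 2 ≤ k) :
    MixedSpline.tensorSplineSpace k p₁ r₁ ≤ MixedSpline.mixedSpace s k p₁ r₁ p₂ r₂ ∧
    MixedSpline.mixedSpace s k p₁ r₁ p₂ r₂ ≤ MixedSpline.tensorSplineSpace k p₂ r₂ ∧
    MixedSpline.LocallyReproduces k p₁ (MixedSpline.mixedSpace s k p₁ r₁ p₂ r₂) :=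
  theorem3_general s k p₁ r₁ p₂ r₂ (by omega) (by omega) (by omega) (by omega) (by omega)
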